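/- For a polynomial $f\in\mathbb{C}[x_1,\dots,x_n]$ and $w\in\mathbb{R}^n$ let $\mathrm{in}_w(f)$ be the sum of the terms of $f$ of lowest $w$-weight, and for an ideal $I$ let $\mathrm{in}_w(I)=\langle \mathrm{in}_w(f): f\in I\rangle$. The tropical variety of $I$ is $$\mathcal{T}(I)=\{w\in\mathbb{R}^n : \mathrm{in}_w(f)\text{ is not a monomial (a single nonzero term), for every } f\in I\}.$$ The Gröbner cone of $w$ is the closure $C_w(I)$ of $\{v\in\mathbb{R}^n : \mathrm{in}_v(I)=\mathrm{in}_w(I)\}$, and the Gröbner fan of $I$ consists of all cones $C_w(I)$ with $w\in\mathbb{R}^n_{<0}$, together with all their nonempty faces. (If $I$ is homogeneous, these are the Gröbner cones of all $w\in\mathbb{R}^n$ and their faces.) A ray is a closed half-line $\mathbb{R}_{\ge 0}v$ with $v\neq 0$; the rays of a fan are the rays that belong to it as cones. **Theorem.** For every integer $p\ge 1$ let $$I_p=\bigl\langle\, x-(z+1)^{p+2},\; y-(z-1)^p \,\bigr\rangle\subset\mathbb{C}[x,y,z].$$ Then $\mathcal{T}(I_p)\subset\mathbb{R}^3$ is the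 union of exactly $4$ distinct rays, while the Gröbner fan of $I_p$ has at least $\tfrac14(p+1)$ rays. -/

import Mathlib

open MvPolynomial

noncomputable section

/-- The exponents of the terms of `f` whose `w`-weight `∑ i, w i * u i` is minimal among all terms
of `f`. -/
def minWeightSupport {n : ℕ} (w : Fin n → ℝ) (f : MvPolynomial (Fin n) ℂ) : Set (Fin n →₀ ℕ) :=
  {u | u ∈ f.support ∧ ∀ v ∈ f.support, ∑ i, w i * (u i : ℝ) ≤ ∑ i, w i * (v i : ℝ)}

open Classical in
/-- The initial form `in_w(f)`: the sum of the terms of `f` of minimal `w`-weight (and `in_w(0) = 0`). -/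
def initialForm {n : ℕ} (w : Fin n → ℝ) (f : MvPolynomial (Fin n) ℂ) : MvPolynomial (Fin n) ℂ :=
  ∑ u ∈ f.support with u ∈ minWeightSupport w f, monomial u (coeff u f)

/-- The initial ideal `in_w(I) = ⟨in_w(f) : f ∈ I⟩`. -/
def initialIdeal {n : ℕ} (w : Fin n → ℝ) (I : Ideal (MvPolynomial (Fin n) ℂ)) :
    Ideal (MvPolynomial (Fin n) ℂ) :=
  Ideal.span {g | ∃ f ∈ I, g = initialForm w f}

/-- The tropical hypersurface of `f`: the weights `w` for which `in_w(f)` is not a monomial, that is,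
does not consist of a single term. -/
def tropicalHypersurface {n : ℕ} (f : MvPolynomial (Fin n) ℂ) : Set (Fin n → ℝ) :=
  {w | ¬ ∃ (u : Fin n →₀ ℕ) (c : ℂ), c ≠ 0 ∧ initialForm w f = monomial u c}

/-- The tropical variety of `I`: the intersection of the tropical hypersurfaces of all `f ∈ I`. -/
def tropicalVariety {n : ℕ} (I : Ideal (MvPolynomial (Fin n) ℂ)) : Set (Fin n → ℝ) :=
  ⋂ f ∈ I, tropicalHypersurface f

/-- The Gröbner cone `C_w(I)`: the closure of the set of weights with the same initial ideal
as `w`. -/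
def groebnerCone {n : ℕ} (I : Ideal (MvPolynomial (Fin n) ℂ)) (w : Fin n → ℝ) :
    Set (Fin n → ℝ) :=
  closure {v | initialIdeal v I = initialIdeal w I}

/-- The Gröbner fan of an arbitrary (not necessarily homogeneous) ideal: all nonempty faces, the
cone itself included, of the Gröbner cones `C_w(I)` of the weights `w` with negative coordinates.
Initial forms are of minimal weight here, so these are the weights for which every nonconstant
monomial precedes `1`, as for a term order. If `I` is homogeneous, every Gröbner cone is of this form,
since adding a multiple of `(1, …, 1)` to a weight does not change the initial ideal. -/
def groebnerFan {n : ℕ} (I : Ideal (MvPolynomial (Fin n) ℂ)) : Set (Set (Fin n → ℝ)) :=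
  {F | F.Nonempty ∧ ∃ w : Fin n → ℝ, (∀ i, w i < 0) ∧ IsExposed ℝ (groebnerCone I w) F}

/-- A ray: a closed half-line issuing from the origin. -/
def IsRay {n : ℕ} (r : Set (Fin n → ℝ)) : Prop :=
  ∃ v : Fin n → ℝ, v ≠ 0 ∧ r = {w | ∃ t : ℝ, 0 ≤ t ∧ w = t • v}

/-- The ideal `⟨x - (z + 1) ^ (p + 2), y - (z - 1) ^ p⟩` of `ℂ[x, y, z]`. -/
def curveIdeal (p : ℕ) : Ideal (MvPolynomial (Fin 3) ℂ) :=
  Ideal.span {X 0 - (X 2 + 1) ^ (p + 2), X 1 - (X 2 - 1) ^ p}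

end

/-! The ideal is the kernel of the parametrization `curveMap p`, z ↦ ((z+1)^(p+2), (z-1)^p, z), so
membership is a question about polynomials in one variable.

Tropical variety: each coordinate vanishes at a point (z = -1, 1, 0) where the other two do not,
which gives the three coordinate rays; the place z = ∞ gives the ray of `rayVec p`. Conversely, the
two generators restrict w to these rays or to the quadrant w 2 = 0, w 0, w 1 ≥ 0, and a Bézout
relation between the coprime powers excludes the interior of that quadrant.

Gröbner rays: a dimension count gives A (z+1)^(p+2) + B (z-1)^p + C = 0 with degrees at most k, k+2,
p-k-1 (`exists_relation`). A Wronskian argument in the style of Mason–Stothers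
(`natDegree_of_relation`) shows that these bounds are attained. With m = p-2k-3, the terms x z^k, y
z^(k+2), z^(m+k+2) of A x + B y + C then tie for the weight -(m+2, m, 1). If m ≥ k+1, no element of
the ideal within this weight bound contains the first of these terms without the other two
(`coeff_zero_or_ne_zero`). A weight v with the same initial ideal must therefore give all three the
same weight (`exists_mem_of_initialIdeal_eq`), which makes v proportional to -(m+2, m, 1), so that
the Gröbner cone is a ray. The admissible k, together with the ray at infinity, give ⌊(p-1)/3⌋ + 1 ≥
(p+1)/4 rays. -/

/-! ### Initial forms and initial ideals -/

theorem coeff_initialForm {n : ℕ} (w : Fin n → ℝ) (f : MvPolynomial (Fin n) ℂ) (u : Fin n →₀ ℕ)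
    [Decidable (u ∈ minWeightSupport w f)] :
    coeff u (initialForm w f) = if u ∈ minWeightSupport w f then coeff u f else 0 := by
  classical
  rw [initialForm, coeff_sum]
  simp only [coeff_monomial, Finset.sum_ite_eq', Finset.mem_filter]
  by_cases h : u ∈ minWeightSupport w f
  · simp [h, h.1]
  · simp [h]

theorem initialForm_eq_monomial_iff {n : ℕ} (w : Fin n → ℝ) (f : MvPolynomial (Fin n) ℂ) :
    (∃ (u : Fin n →₀ ℕ) (c : ℂ), c ≠ 0 ∧ initialForm w f = monomial u c) ↔
      ∃ u ∈ f.support, ∀ v ∈ f.support, v ≠ u →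
        ∑ i, w i * (u i : ℝ) < ∑ i, w i * (v i : ℝ) := by
  classical
  constructor
  · rintro ⟨u, c, hc, h⟩
    have hu : u ∈ minWeightSupport w f := by
      by_contra hu
      have := coeff_initialForm w f u
      simp [h, hu, hc] at this
    refine ⟨u, hu.1, fun v hv hvu => lt_of_le_of_ne (hu.2 v hv) fun he => ?_⟩
    have hv' : v ∈ minWeightSupport w f := ⟨hv, fun y hy => he ▸ hu.2 y hy⟩
    have := coeff_initialForm w f v
    rw [if_pos hv', h, coeff_monomial, if_neg (Ne.symm hvu)] at this
    exact (mem_support_iff.1 hv) this.symm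
  · rintro ⟨u, hu, h⟩
    refine ⟨u, coeff u f, mem_support_iff.1 hu, ?_⟩
    ext v
    rw [coeff_initialForm, coeff_monomial]
    by_cases hv : v = u
    · subst hv
      rw [if_pos, if_pos rfl]
      refine ⟨hu, fun y hy => ?_⟩
      by_cases hy' : y = v
      · rw [hy']
      · exact (h y hy hy').le
    · rw [if_neg, if_neg (Ne.symm hv)]
      exact fun hv' => absurd (hv'.2 u hu) (not_le.2 (h v hv'.1 hv))

/-- Weight components of an initial ideal lift to elements of `I`: this holds for initial forms and
survives sums, while multiplication by a monomial only shifts `d`. Hence the generalization over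
`d`. -/
theorem exists_mem_of_mem_initialIdeal {n : ℕ} {w : Fin n → ℝ}
    {I : Ideal (MvPolynomial (Fin n) ℂ)} {g : MvPolynomial (Fin n) ℂ}
    (hg : g ∈ initialIdeal w I) (d : ℝ) :
    ∃ f ∈ I, ∀ u : Fin n →₀ ℕ, (∑ i, w i * (u i : ℝ) < d → coeff u f = 0) ∧
      (∑ i, w i * (u i : ℝ) = d → coeff u f = coeff u g) := by
  classical
  induction hg using Submodule.span_induction generalizing d with
  | mem g hg =>
    obtain ⟨f, hf, rfl⟩ := hg
    by_cases hd : ∃ u ∈ minWeightSupport w f, ∑ i, w i * (u i : ℝ) = d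
    · obtain ⟨u₀, hu₀, rfl⟩ := hd
      refine ⟨f, hf, fun u => ⟨fun hu => ?_, fun hu => ?_⟩⟩
      · by_contra hne
        exact absurd (hu₀.2 u (mem_support_iff.2 hne)) (not_le.2 hu)
      · rw [coeff_initialForm]
        split_ifs with h
        · rfl
        · by_contra hne
          exact h ⟨mem_support_iff.2 hne, fun v hv => hu ▸ hu₀.2 v hv⟩
    · refine ⟨0, I.zero_mem, fun u => ⟨fun _ => rfl, fun hu => ?_⟩⟩
      rw [coeff_initialForm, if_neg fun h => hd ⟨u, h, hu⟩, coeff_zero]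
  | zero => exact ⟨0, I.zero_mem, fun u => ⟨fun _ => rfl, fun _ => rfl⟩⟩
  | add g₁ g₂ _ _ h₁ h₂ =>
    obtain ⟨f₁, hf₁, h₁⟩ := h₁ d
    obtain ⟨f₂, hf₂, h₂⟩ := h₂ d
    refine ⟨f₁ + f₂, I.add_mem hf₁ hf₂, fun u => ⟨fun hu => ?_, fun hu => ?_⟩⟩
    · rw [coeff_add, (h₁ u).1 hu, (h₂ u).1 hu, add_zero]
    · rw [coeff_add, (h₁ u).2 hu, (h₂ u).2 hu, coeff_add]
  | smul a g _ h =>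
    induction a using MvPolynomial.induction_on' generalizing d with
    | monomial s c =>
      obtain ⟨f, hf, hfg⟩ := h (d - ∑ i, w i * (s i : ℝ))
      have key : ∀ u : Fin n →₀ ℕ, s ≤ u →
          ∑ i, w i * ((u - s) i : ℝ) = ∑ i, w i * (u i : ℝ) - ∑ i, w i * (s i : ℝ) := by
        intro u hu
        rw [← Finset.sum_sub_distrib]
        refine Finset.sum_congr rfl fun i _ => ?_
        rw [Finsupp.tsub_apply, Nat.cast_sub (hu i)]
        ring
      refine ⟨monomial s c * f, I.mul_mem_left _ hf, fun u => ⟨fun hu => ?_, fun hu => ?_⟩⟩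
      · rw [coeff_monomial_mul']
        split_ifs with hs
        · rw [(hfg (u - s)).1 (by rw [key u hs]; linarith), mul_zero]
        · rfl
      · rw [smul_eq_mul, coeff_monomial_mul', coeff_monomial_mul']
        split_ifs with hs
        · rw [(hfg (u - s)).2 (by rw [key u hs]; linarith)]
        · rfl
    | add a b ha hb =>
      obtain ⟨f₁, hf₁, h₁⟩ := ha d
      obtain ⟨f₂, hf₂, h₂⟩ := hb d
      refine ⟨f₁ + f₂, I.add_mem hf₁ hf₂, fun u => ⟨fun hu => ?_, fun hu => ?_⟩⟩
      · rw [coeff_add, (h₁ u).1 hu, (h₂ u).1 hu, add_zero]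
      · rw [coeff_add, (h₁ u).2 hu, (h₂ u).2 hu, add_smul, coeff_add]

theorem initialForm_mem_initialIdeal {n : ℕ} (w : Fin n → ℝ)
    {I : Ideal (MvPolynomial (Fin n) ℂ)} {f : MvPolynomial (Fin n) ℂ} (hf : f ∈ I) :
    initialForm w f ∈ initialIdeal w I :=
  Ideal.subset_span ⟨f, hf, rfl⟩

/-- If `r` and `v` have the same initial ideal, then the `v`-homogeneous parts of an `r`-initial
form are again `r`-initial forms of elements of the ideal. -/
theorem exists_mem_of_initialIdeal_eq {n : ℕ} {r v : Fin n → ℝ}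
    {I : Ideal (MvPolynomial (Fin n) ℂ)} (h : initialIdeal v I = initialIdeal r I)
    {F : MvPolynomial (Fin n) ℂ} (hF : F ∈ I) {u₀ : Fin n →₀ ℕ}
    (hu₀ : u₀ ∈ minWeightSupport r F) :
    ∃ f ∈ I, ∀ u : Fin n →₀ ℕ,
      (∑ i, r i * (u i : ℝ) < ∑ i, r i * (u₀ i : ℝ) → coeff u f = 0) ∧
      (∑ i, r i * (u i : ℝ) = ∑ i, r i * (u₀ i : ℝ) → coeff u f =
        if ∑ i, v i * (u i : ℝ) = ∑ i, v i * (u₀ i : ℝ) then coeff u F else 0) := by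
  classical
  have hF' := initialForm_mem_initialIdeal r hF
  have hcoeff : ∀ u : Fin n →₀ ℕ, ∑ i, r i * (u i : ℝ) = ∑ i, r i * (u₀ i : ℝ) →
      coeff u (initialForm r F) = coeff u F := by
    intro u hu
    rw [coeff_initialForm]
    split_ifs with hm
    · rfl
    · by_contra hne
      exact hm ⟨mem_support_iff.2 (Ne.symm hne), fun y hy => hu ▸ hu₀.2 y hy⟩
  -- Lifting through the `v`-initial ideal isolates the component of the `v`-weight of `u₀`; lifting
  -- back through the `r`-initial ideal realizes that component at the bottom of some `f`.
  rw [← h] at hF'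
  obtain ⟨g, hg, hgF⟩ := exists_mem_of_mem_initialIdeal hF' (∑ i, v i * (u₀ i : ℝ))
  have hg' := initialForm_mem_initialIdeal v hg
  rw [h] at hg'
  obtain ⟨f, hf, hfg⟩ := exists_mem_of_mem_initialIdeal hg' (∑ i, r i * (u₀ i : ℝ))
  have hmin : ∀ y ∈ g.support, ∑ i, v i * (u₀ i : ℝ) ≤ ∑ i, v i * (y i : ℝ) := by
    intro y hy
    by_contra hlt
    exact mem_support_iff.1 hy ((hgF y).1 (not_le.1 hlt))
  have hu₀g : u₀ ∈ g.support := by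
    rw [mem_support_iff, (hgF u₀).2 rfl, hcoeff u₀ rfl]
    exact mem_support_iff.1 hu₀.1
  refine ⟨f, hf, fun u => ⟨(hfg u).1, fun hu => ?_⟩⟩
  rw [(hfg u).2 hu, coeff_initialForm]
  by_cases hv : ∑ i, v i * (u i : ℝ) = ∑ i, v i * (u₀ i : ℝ)
  · rw [if_pos hv]
    split_ifs with hm
    · rw [(hgF u).2 hv, hcoeff u hu]
    · by_contra hne
      refine hm ⟨mem_support_iff.2 ?_, fun y hy => hv ▸ hmin y hy⟩
      rw [(hgF u).2 hv, hcoeff u hu]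
      exact Ne.symm hne
  · rw [if_neg hv, if_neg]
    exact fun hm => hv (le_antisymm (hm.2 u₀ hu₀g) (hmin u hm.1))

/-! ### Gröbner cones that are half-lines -/

theorem initialForm_smul {n : ℕ} {t : ℝ} (ht : 0 < t) (w : Fin n → ℝ)
    (f : MvPolynomial (Fin n) ℂ) : initialForm (t • w) f = initialForm w f := by
  classical
  ext u
  have : u ∈ minWeightSupport (t • w) f ↔ u ∈ minWeightSupport w f := by
    simp only [minWeightSupport, Set.mem_ofPred_eq, Pi.smul_apply, smul_eq_mul, mul_assoc,
      ← Finset.mul_sum, mul_le_mul_iff_of_pos_left ht]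
  rw [coeff_initialForm, coeff_initialForm]
  simp only [this]

theorem initialIdeal_smul {n : ℕ} {t : ℝ} (ht : 0 < t) (w : Fin n → ℝ)
    (I : Ideal (MvPolynomial (Fin n) ℂ)) : initialIdeal (t • w) I = initialIdeal w I := by
  simp only [initialIdeal, initialForm_smul ht]

/-- The closed half-line spanned by `v`. -/
def halfLine {n : ℕ} (v : Fin n → ℝ) : Set (Fin n → ℝ) :=
  {w | ∃ t : ℝ, 0 ≤ t ∧ w = t • v}

theorem groebnerCone_eq_halfLine {n : ℕ} {I : Ideal (MvPolynomial (Fin n) ℂ)} {r : Fin n → ℝ}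
    (h : ∀ v, initialIdeal v I = initialIdeal r I → ∃ t : ℝ, 0 < t ∧ v = t • r) :
    groebnerCone I r = halfLine r := by
  have h₁ : {v | initialIdeal v I = initialIdeal r I} = (fun t : ℝ => t • r) '' Set.Ioi 0 := by
    ext v
    constructor
    · intro hv
      obtain ⟨t, ht, rfl⟩ := h v hv
      exact ⟨t, ht, rfl⟩
    · rintro ⟨t, ht, rfl⟩
      exact initialIdeal_smul ht r I
  have h₂ : halfLine r = (fun t : ℝ => t • r) '' Set.Ici 0 := by
    ext v
    constructor
    · rintro ⟨t, ht, rfl⟩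
      exact ⟨t, ht, rfl⟩
    · rintro ⟨t, ht, rfl⟩
      exact ⟨t, ht, rfl⟩
  rw [groebnerCone, h₁, h₂, ← closure_Ioi (0 : ℝ)]
  exact (isClosedMap_smul_left r).closure_image_eq_of_continuous (by fun_prop) _

theorem halfLine_mem_groebnerFan {n : ℕ} {I : Ideal (MvPolynomial (Fin n) ℂ)} {r : Fin n → ℝ}
    (hr : ∀ i, r i < 0)
    (h : ∀ v, initialIdeal v I = initialIdeal r I → ∃ t : ℝ, 0 < t ∧ v = t • r) :
    halfLine r ∈ groebnerFan I := by
  refine ⟨⟨r, 1, zero_le_one, (one_smul ℝ r).symm⟩, r, hr, ?_⟩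
  rw [groebnerCone_eq_halfLine h]

/-! ### Degrees in relations between (X+1)^(p+2), (X-1)^p and 1 -/

/-- The coefficient is (deg P - deg C) times the product of the leading coefficients. This makes the
Wronskian nonzero. -/
theorem natDegree_derivative_mul_sub {P C : Polynomial ℂ} (hP : P ≠ 0) (hC : C ≠ 0)
    (h : C.natDegree < P.natDegree) :
    (Polynomial.derivative P * C - P * Polynomial.derivative C).coeff
      (P.natDegree + C.natDegree - 1) ≠ 0 := by
  have h1 : (Polynomial.derivative P * C).coeff (P.natDegree + C.natDegree - 1) =
      P.natDegree * P.leadingCoeff * C.leadingCoeff := by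
    have e : P.natDegree + C.natDegree - 1 = (P.natDegree - 1) + C.natDegree := by omega
    rw [e, Polynomial.coeff_mul_add_eq_of_natDegree_le (Polynomial.natDegree_derivative_le P) le_rfl,
      Polynomial.coeff_derivative, Nat.sub_add_cancel (by omega)]
    rw [← Nat.cast_add_one, Nat.sub_add_cancel (by omega)]
    simp only [Polynomial.coeff_natDegree]
    ring
  have h2 : (P * Polynomial.derivative C).coeff (P.natDegree + C.natDegree - 1) =
      C.natDegree * P.leadingCoeff * C.leadingCoeff := by
    rcases Nat.eq_zero_or_pos C.natDegree with h0 | h0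
    · rw [Polynomial.eq_C_of_natDegree_eq_zero h0]
      simp
    · have e : P.natDegree + C.natDegree - 1 = P.natDegree + (C.natDegree - 1) := by omega
      rw [e, Polynomial.coeff_mul_add_eq_of_natDegree_le le_rfl
        (Polynomial.natDegree_derivative_le C),
        Polynomial.coeff_derivative, Nat.sub_add_cancel (by omega)]
      rw [← Nat.cast_add_one, Nat.sub_add_cancel (by omega)]
      simp only [Polynomial.coeff_natDegree]
      ring
  rw [Polynomial.coeff_sub, h1, h2, ← sub_mul, ← sub_mul]
  refine mul_ne_zero (mul_ne_zero (sub_ne_zero.2 ?_) (Polynomial.leadingCoeff_ne_zero.2 hP))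
    (Polynomial.leadingCoeff_ne_zero.2 hC)
  exact_mod_cast h.ne'

theorem isCoprime_X_add_one_X_sub_one :
    IsCoprime (Polynomial.X + 1 : Polynomial ℂ) (Polynomial.X - 1) := by
  refine ⟨Polynomial.C (1 / 2), -Polynomial.C (1 / 2), ?_⟩
  have : (Polynomial.C (1 / 2) + Polynomial.C (1 / 2) : Polynomial ℂ) = 1 := by
    rw [← Polynomial.C_add]; norm_num
  linear_combination this

theorem natDegree_X_add_one_pow (n : ℕ) :
    ((Polynomial.X + 1 : Polynomial ℂ) ^ n).natDegree = n := by
  rw [Polynomial.natDegree_pow, ← Polynomial.C_1, Polynomial.natDegree_X_add_C, mul_one]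

theorem natDegree_X_sub_one_pow (n : ℕ) :
    ((Polynomial.X - 1 : Polynomial ℂ) ^ n).natDegree = n := by
  rw [Polynomial.natDegree_pow, ← Polynomial.C_1, Polynomial.natDegree_X_sub_C, mul_one]

theorem X_add_one_pow_ne_zero (n : ℕ) : (Polynomial.X + 1 : Polynomial ℂ) ^ n ≠ 0 := by
  rw [← Polynomial.C_1]
  exact ((Polynomial.monic_X_add_C 1).pow n).ne_zero

theorem X_sub_one_pow_ne_zero (n : ℕ) : (Polynomial.X - 1 : Polynomial ℂ) ^ n ≠ 0 := by
  rw [← Polynomial.C_1]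
  exact ((Polynomial.monic_X_sub_C 1).pow n).ne_zero

/-- Lower bound for the degrees in a relation between `(X + 1) ^ (p + 2)`, `(X - 1) ^ p` and `1`
with polynomial coefficients, obtained from the Wronskian of the summands. -/
theorem natDegree_of_relation {p : ℕ} (hp : 1 ≤ p) {A B C : Polynomial ℂ}
    (hA : A.natDegree < p) (hC : C.natDegree < p)
    (h : A * (Polynomial.X + 1) ^ (p + 2) + B * (Polynomial.X - 1) ^ p + C = 0)
    (hne : ¬ (A = 0 ∧ B = 0 ∧ C = 0)) :
    A ≠ 0 ∧ B ≠ 0 ∧ C ≠ 0 ∧ p ≤ A.natDegree + C.natDegree + 1 ∧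
      B.natDegree = A.natDegree + 2 := by
  have hA0 : A ≠ 0 := by
    rintro rfl
    rw [zero_mul, zero_add] at h
    have hB : B = 0 := by
      by_contra hB
      have h1 : B * (Polynomial.X - 1) ^ p = -C := by linear_combination h
      have h2 := congrArg Polynomial.natDegree h1
      rw [Polynomial.natDegree_mul hB (X_sub_one_pow_ne_zero p), natDegree_X_sub_one_pow,
        Polynomial.natDegree_neg] at h2
      omega
    subst hB
    simp at h
    exact hne ⟨rfl, rfl, h⟩
  have hC0 : C ≠ 0 := by
    rintro rfl
    have hd : (Polynomial.X - 1 : Polynomial ℂ) ^ p ∣ A * (Polynomial.X + 1) ^ (p + 2) :=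
      ⟨-B, by linear_combination h⟩
    have hd' := (isCoprime_X_add_one_X_sub_one.symm.pow (m := p) (n := p + 2)).dvd_of_dvd_mul_right hd
    have := Polynomial.natDegree_le_of_dvd hd' hA0
    rw [natDegree_X_sub_one_pow] at this
    omega
  have hPdeg : (A * (Polynomial.X + 1) ^ (p + 2)).natDegree = A.natDegree + (p + 2) := by
    rw [Polynomial.natDegree_mul hA0 (X_add_one_pow_ne_zero _), natDegree_X_add_one_pow]
  have hP0 : A * (Polynomial.X + 1) ^ (p + 2) ≠ 0 := mul_ne_zero hA0 (X_add_one_pow_ne_zero _)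
  have hQ : B * (Polynomial.X - 1) ^ p = -(A * (Polynomial.X + 1) ^ (p + 2) + C) := by
    linear_combination h
  have hQdeg : (B * (Polynomial.X - 1) ^ p).natDegree = A.natDegree + (p + 2) := by
    rw [hQ, Polynomial.natDegree_neg, Polynomial.natDegree_add_eq_left_of_natDegree_lt, hPdeg]
    omega
  have hB0 : B ≠ 0 := by
    rintro rfl
    simp at hQdeg
  rw [Polynomial.natDegree_mul hB0 (X_sub_one_pow_ne_zero p), natDegree_X_sub_one_pow] at hQdeg
  refine ⟨hA0, hB0, hC0, ?_, by omega⟩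
  -- The relation lets the Wronskian be computed from either large summand, so (X+1)^(p+1)
  -- (X-1)^(p-1) divides it. Its degree is thus at least 2p, and at most deg A + p + 2 + deg C - 1.
  have hW := natDegree_derivative_mul_sub hP0 hC0 (by omega)
  set W := Polynomial.derivative (A * (Polynomial.X + 1) ^ (p + 2)) * C -
    A * (Polynomial.X + 1) ^ (p + 2) * Polynomial.derivative C with hWdef
  have hW0 : W ≠ 0 := by
    intro h0
    rw [h0] at hW
    simp at hW
  have hWdeg : W.natDegree ≤ A.natDegree + (p + 2) + C.natDegree - 1 := by
    rw [hWdef]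
    refine (Polynomial.natDegree_sub_le _ _).trans (max_le ?_ ?_)
    · refine Polynomial.natDegree_mul_le.trans ?_
      have := Polynomial.natDegree_derivative_le (A * (Polynomial.X + 1) ^ (p + 2))
      omega
    · rcases Nat.eq_zero_or_pos C.natDegree with h0 | h0
      · rw [Polynomial.eq_C_of_natDegree_eq_zero h0]
        simp
      · refine Polynomial.natDegree_mul_le.trans ?_
        have := Polynomial.natDegree_derivative_le C
        omega
  obtain ⟨q, rfl⟩ : ∃ q, p = q + 1 := ⟨p - 1, by omega⟩
  have hdu : (Polynomial.X + 1 : Polynomial ℂ) ^ (q + 2) ∣ W := by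
    refine ⟨(Polynomial.derivative A * (Polynomial.X + 1) + A * ((q + 3 : ℕ) : Polynomial ℂ)) * C -
      A * (Polynomial.X + 1) * Polynomial.derivative C, ?_⟩
    rw [hWdef]
    simp only [Polynomial.derivative_mul, Polynomial.derivative_pow, Polynomial.derivative_add,
      Polynomial.derivative_X, Polynomial.derivative_one, Polynomial.C_eq_natCast]
    push_cast
    ring
  have hdv : (Polynomial.X - 1 : Polynomial ℂ) ^ q ∣ W := by
    have hWe : W = -Polynomial.derivative (B * (Polynomial.X - 1) ^ (q + 1)) * C +
        B * (Polynomial.X - 1) ^ (q + 1) * Polynomial.derivative C := by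
      have : A * (Polynomial.X + 1) ^ (q + 1 + 2) = -(B * (Polynomial.X - 1) ^ (q + 1)) - C := by
        linear_combination h
      rw [hWdef, this, Polynomial.derivative_sub, Polynomial.derivative_neg]
      ring
    refine ⟨-(Polynomial.derivative B * (Polynomial.X - 1) + B * ((q + 1 : ℕ) : Polynomial ℂ)) * C +
      B * (Polynomial.X - 1) * Polynomial.derivative C, ?_⟩
    rw [hWe]
    simp only [Polynomial.derivative_mul, Polynomial.derivative_pow, Polynomial.derivative_sub,
      Polynomial.derivative_X, Polynomial.derivative_one, Polynomial.C_eq_natCast]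
    push_cast
    ring
  have hd := (isCoprime_X_add_one_X_sub_one.pow (m := q + 2) (n := q)).mul_dvd hdu hdv
  have hle := Polynomial.natDegree_le_of_dvd hd hW0
  rw [Polynomial.natDegree_mul (X_add_one_pow_ne_zero _) (X_sub_one_pow_ne_zero _),
    natDegree_X_add_one_pow, natDegree_X_sub_one_pow] at hle
  omega

/-- Linear algebra: A and B have 2k+4 free coefficients, and only the 2k+3 coefficients in degrees
p-k, …, p+k+2 have to vanish for the remainder C to be small. -/
theorem exists_relation (p k : ℕ) (hk : k < p) :
    ∃ A B C : Polynomial ℂ, A.natDegree ≤ k ∧ B.natDegree ≤ k + 2 ∧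
      C.natDegree ≤ p - k - 1 ∧ ¬ (A = 0 ∧ B = 0 ∧ C = 0) ∧
      A * (Polynomial.X + 1) ^ (p + 2) + B * (Polynomial.X - 1) ^ p + C = 0 := by
  let Φ : Polynomial ℂ × Polynomial ℂ →ₗ[ℂ] Polynomial ℂ :=
    (LinearMap.mulRight ℂ ((Polynomial.X + 1) ^ (p + 2))).coprod
      (LinearMap.mulRight ℂ ((Polynomial.X - 1) ^ p))
  let L : (Polynomial.degreeLT ℂ (k + 1)) × (Polynomial.degreeLT ℂ (k + 3)) →ₗ[ℂ]
      (Fin (2 * k + 3) → ℂ) :=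
    LinearMap.pi fun i => (Polynomial.lcoeff ℂ (p - k + i)).comp
      (Φ.comp ((Polynomial.degreeLT ℂ (k + 1)).subtype.prodMap
        (Polynomial.degreeLT ℂ (k + 3)).subtype))
  have e1 := Polynomial.degreeLTEquiv ℂ (k + 1)
  have e2 := Polynomial.degreeLTEquiv ℂ (k + 3)
  have : FiniteDimensional ℂ (Polynomial.degreeLT ℂ (k + 1)) := e1.symm.finiteDimensional
  have : FiniteDimensional ℂ (Polynomial.degreeLT ℂ (k + 3)) := e2.symm.finiteDimensional
  have hker : LinearMap.ker L ≠ ⊥ := by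
    apply LinearMap.ker_ne_bot_of_finrank_lt
    rw [Module.finrank_prod, e1.finrank_eq, e2.finrank_eq]
    simp only [Module.finrank_fin_fun]
    omega
  obtain ⟨⟨⟨A, hA⟩, ⟨B, hB⟩⟩, hmem, hne⟩ := Submodule.exists_mem_ne_zero_of_ne_bot hker
  have hA' : A.natDegree ≤ k := by
    rw [Polynomial.mem_degreeLT] at hA
    exact Polynomial.natDegree_le_iff_coeff_eq_zero.2 fun N hN =>
      Polynomial.coeff_eq_zero_of_degree_lt (hA.trans_le (by exact_mod_cast hN))
  have hB' : B.natDegree ≤ k + 2 := by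
    rw [Polynomial.mem_degreeLT] at hB
    exact Polynomial.natDegree_le_iff_coeff_eq_zero.2 fun N hN =>
      Polynomial.coeff_eq_zero_of_degree_lt (hB.trans_le (by exact_mod_cast hN))
  have hco : ∀ i : Fin (2 * k + 3),
      (A * (Polynomial.X + 1) ^ (p + 2) + B * (Polynomial.X - 1) ^ p).coeff (p - k + i) = 0 :=
    fun i => congrFun (LinearMap.mem_ker.1 hmem) i
  refine ⟨A, B, -(A * (Polynomial.X + 1) ^ (p + 2) + B * (Polynomial.X - 1) ^ p), hA', hB', ?_, ?_,
    by ring⟩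
  · rw [Polynomial.natDegree_neg, Polynomial.natDegree_le_iff_coeff_eq_zero]
    intro N hN
    by_cases hN' : N ≤ p + k + 2
    · have := hco ⟨N - (p - k), by omega⟩
      rwa [show p - k + (N - (p - k)) = N by omega] at this
    · apply Polynomial.coeff_eq_zero_of_natDegree_lt
      refine (Polynomial.natDegree_add_le _ _).trans_lt (max_lt ?_ ?_)
      · refine Polynomial.natDegree_mul_le.trans_lt ?_
        rw [natDegree_X_add_one_pow]
        omega
      · refine Polynomial.natDegree_mul_le.trans_lt ?_
        rw [natDegree_X_sub_one_pow]
        omega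
  · rintro ⟨rfl, rfl, -⟩
    exact hne rfl

/-! ### The parametrization and membership in the ideal -/

/-- The exponent vector `(i, j, l)`. -/
noncomputable def expVec (i j l : ℕ) : Fin 3 →₀ ℕ := Finsupp.equivFunOnFinite.symm ![i, j, l]

@[simp] theorem expVec_zero (i j l : ℕ) : expVec i j l 0 = i := rfl
@[simp] theorem expVec_one (i j l : ℕ) : expVec i j l 1 = j := rfl
@[simp] theorem expVec_two (i j l : ℕ) : expVec i j l 2 = l := rfl

theorem eq_expVec_iff {u : Fin 3 →₀ ℕ} {i j l : ℕ} :
    u = expVec i j l ↔ u 0 = i ∧ u 1 = j ∧ u 2 = l := by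
  constructor
  · rintro rfl
    simp
  · rintro ⟨rfl, rfl, rfl⟩
    ext s
    fin_cases s <;> rfl

/-- The parametrization of the curve defined by `curveIdeal p`. -/
noncomputable def curveMap (p : ℕ) : MvPolynomial (Fin 3) ℂ →ₐ[ℂ] Polynomial ℂ :=
  aeval ![(Polynomial.X + 1) ^ (p + 2), (Polynomial.X - 1) ^ p, Polynomial.X]

theorem curveMap_monomial (p : ℕ) (u : Fin 3 →₀ ℕ) (c : ℂ) :
    curveMap p (monomial u c) = Polynomial.C c * (((Polynomial.X + 1) ^ (p + 2)) ^ u 0 *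
      ((Polynomial.X - 1) ^ p) ^ u 1 * Polynomial.X ^ u 2) := by
  rw [curveMap, aeval_monomial, Finsupp.prod_fintype _ _ (fun i => pow_zero _),
    Fin.prod_univ_three]
  rfl

/-- Polynomials in `z`, regarded as polynomials in `x`, `y`, `z`. -/
noncomputable def inZ : Polynomial ℂ →ₐ[ℂ] MvPolynomial (Fin 3) ℂ :=
  Polynomial.aeval (X 2)

theorem curveMap_inZ (p : ℕ) (A : Polynomial ℂ) : curveMap p (inZ A) = A := by
  have : (curveMap p).comp inZ = AlgHom.id ℂ (Polynomial ℂ) := by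
    apply Polynomial.algHom_ext
    simp [curveMap, inZ]
  exact DFunLike.congr_fun this A

theorem coeff_inZ (A : Polynomial ℂ) (u : Fin 3 →₀ ℕ) :
    coeff u (inZ A) = if u 0 = 0 ∧ u 1 = 0 then A.coeff (u 2) else 0 := by
  rw [inZ, Polynomial.aeval_eq_sum_range, coeff_sum]
  have h : ∀ i, coeff u (A.coeff i • (X 2 : MvPolynomial (Fin 3) ℂ) ^ i) =
      if u = expVec 0 0 i then A.coeff i else 0 := by
    intro i
    rw [coeff_smul, coeff_X_pow, smul_eq_mul, mul_ite, mul_one, mul_zero]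
    have : (Finsupp.single (2 : Fin 3) i = u) ↔ u = expVec 0 0 i := by
      rw [eq_comm, show Finsupp.single (2 : Fin 3) i = expVec 0 0 i from
        eq_expVec_iff.2 (by simp)]
    simp only [this]
  simp only [h, eq_expVec_iff]
  split_ifs with hu
  · simp only [hu, true_and]
    rw [Finset.sum_ite_eq]
    split_ifs with hd
    · rfl
    · rw [Polynomial.coeff_eq_zero_of_natDegree_lt]
      simpa using hd
  · exact Finset.sum_eq_zero fun i _ => if_neg fun hi => hu ⟨hi.1, hi.2.1⟩

/-- Modulo the ideal, every `f` is congruent to `inZ (curveMap p f)`, as one checks on the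
variables. -/
theorem mem_curveIdeal_iff {p : ℕ} {f : MvPolynomial (Fin 3) ℂ} :
    f ∈ curveIdeal p ↔ curveMap p f = 0 := by
  constructor
  · intro hf
    have : curveIdeal p ≤ RingHom.ker (curveMap p) := by
      rw [curveIdeal, Ideal.span_le]
      rintro g (rfl | rfl) <;> simp [curveMap]
    exact this hf
  · intro hf
    have key : ((Ideal.Quotient.mkₐ ℂ (curveIdeal p)).comp inZ).comp (curveMap p) =
        Ideal.Quotient.mkₐ ℂ (curveIdeal p) := by
      apply MvPolynomial.algHom_ext
      intro i
      have h0 : X 0 - (X 2 + 1) ^ (p + 2) ∈ curveIdeal p := Ideal.subset_span (by simp)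
      have h1 : X 1 - (X 2 - 1) ^ p ∈ curveIdeal p := Ideal.subset_span (by simp)
      refine Ideal.Quotient.eq.2 ?_
      fin_cases i
      · simpa [curveMap, inZ] using (curveIdeal p).neg_mem h0
      · simpa [curveMap, inZ] using (curveIdeal p).neg_mem h1
      · simp [curveMap, inZ]
    have := DFunLike.congr_fun key f
    simp only [AlgHom.comp_apply, hf, map_zero] at this
    exact Ideal.Quotient.eq_zero_iff_mem.1 this.symm

theorem inZ_mem_combination {p : ℕ} {A B C : Polynomial ℂ}
    (h : A * (Polynomial.X + 1) ^ (p + 2) + B * (Polynomial.X - 1) ^ p + C = 0) :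
    inZ A * X 0 + inZ B * X 1 + inZ C ∈ curveIdeal p := by
  rw [mem_curveIdeal_iff, ← h]
  simp only [map_add, map_mul, curveMap_inZ]
  simp [curveMap]

theorem coeff_combination (A B C : Polynomial ℂ) (u : Fin 3 →₀ ℕ) :
    coeff u (inZ A * X 0 + inZ B * X 1 + inZ C) =
      (if u 0 = 1 ∧ u 1 = 0 then A.coeff (u 2) else 0) +
      (if u 0 = 0 ∧ u 1 = 1 then B.coeff (u 2) else 0) +
      (if u 0 = 0 ∧ u 1 = 0 then C.coeff (u 2) else 0) := by
  rw [coeff_add, coeff_add, coeff_mul_X', coeff_mul_X', coeff_inZ, coeff_inZ, coeff_inZ]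
  congr 2
  · have e0 := fun s => Finsupp.tsub_apply u (Finsupp.single (0 : Fin 3) 1) s
    have e1 : (Finsupp.single (0 : Fin 3) 1) 0 = 1 := by simp
    have e2 : (Finsupp.single (0 : Fin 3) 1) 1 = 0 := by simp
    have e3 : (Finsupp.single (0 : Fin 3) 1) 2 = 0 := by simp
    simp only [Finsupp.mem_support_iff, e0, e1, e2, e3]
    split_ifs <;> first | rfl | omega
  · have e0 := fun s => Finsupp.tsub_apply u (Finsupp.single (1 : Fin 3) 1) s
    have e1 : (Finsupp.single (1 : Fin 3) 1) 0 = 0 := by simp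
    have e2 : (Finsupp.single (1 : Fin 3) 1) 1 = 1 := by simp
    have e3 : (Finsupp.single (1 : Fin 3) 1) 2 = 0 := by simp
    simp only [Finsupp.mem_support_iff, e0, e1, e2, e3]
    split_ifs <;> first | rfl | omega

/-! ### Elements of the ideal of bounded weight -/

/-- The weight bound leaves only monomials linear in x, y or free of x. Multiples of y² can survive
when m is close to k; they go into `E`, whose degree does not matter. -/
theorem exists_normalForm (p : ℕ) {k m : ℕ} (hm : k + 1 ≤ m)
    (f : MvPolynomial (Fin 3) ℂ)
    (hf : ∀ u ∈ f.support, (m + 2) * u 0 + m * u 1 + u 2 ≤ m + k + 2) :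
    ∃ A B C E : Polynomial ℂ, A.natDegree ≤ k ∧ B.natDegree ≤ k + 2 ∧
      C.natDegree ≤ m + k + 2 ∧ A.coeff k = coeff (expVec 1 0 k) f ∧
      B.coeff (k + 2) = coeff (expVec 0 1 (k + 2)) f ∧
      C.coeff (m + k + 2) = coeff (expVec 0 0 (m + k + 2)) f ∧
      curveMap p f = A * (Polynomial.X + 1) ^ (p + 2) + B * (Polynomial.X - 1) ^ p + C +
        E * ((Polynomial.X - 1) ^ p) ^ 2 := by
  classical
  rw [f.as_sum]
  refine Finset.sum_induction _ (fun f => ∃ A B C E : Polynomial ℂ, A.natDegree ≤ k ∧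
      B.natDegree ≤ k + 2 ∧
      C.natDegree ≤ m + k + 2 ∧ A.coeff k = coeff (expVec 1 0 k) f ∧
      B.coeff (k + 2) = coeff (expVec 0 1 (k + 2)) f ∧
      C.coeff (m + k + 2) = coeff (expVec 0 0 (m + k + 2)) f ∧
      curveMap p f = A * (Polynomial.X + 1) ^ (p + 2) + B * (Polynomial.X - 1) ^ p + C +
        E * ((Polynomial.X - 1) ^ p) ^ 2) ?_ ?_ ?_
  · rintro f g ⟨A, B, C, E, hA, hB, hC, hA', hB', hC', h⟩
      ⟨A₁, B₁, C₁, E₁, hA₁, hB₁, hC₁, hA₁', hB₁', hC₁', h₁⟩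
    refine ⟨A + A₁, B + B₁, C + C₁, E + E₁,
      Polynomial.natDegree_add_le_of_degree_le hA hA₁,
      Polynomial.natDegree_add_le_of_degree_le hB hB₁,
      Polynomial.natDegree_add_le_of_degree_le hC hC₁, ?_, ?_, ?_, ?_⟩
    · rw [Polynomial.coeff_add, coeff_add, hA', hA₁']
    · rw [Polynomial.coeff_add, coeff_add, hB', hB₁']
    · rw [Polynomial.coeff_add, coeff_add, hC', hC₁']
    · rw [map_add, h, h₁]
      ring
  · exact ⟨0, 0, 0, 0, by simp, by simp, by simp, by simp, by simp, by simp, by simp⟩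
  · intro u hu
    have hu := hf u hu
    generalize coeff u f = c
    obtain ⟨i, j, l, rfl⟩ : ∃ i j l, u = expVec i j l := ⟨_, _, _, eq_expVec_iff.2 ⟨rfl, rfl, rfl⟩⟩
    simp only [expVec_zero, expVec_one, expVec_two] at hu
    have hco : ∀ a b t, coeff (expVec a b t) (monomial (expVec i j l) c) =
        if i = a ∧ j = b ∧ l = t then c else 0 := by
      intro a b t
      rw [coeff_monomial]
      simp only [eq_expVec_iff, expVec_zero, expVec_one, expVec_two]
    simp only [hco, curveMap_monomial, expVec_zero, expVec_one, expVec_two]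
    -- As m ≥ k+1, the monomials x² and xy weigh at least 2m+4 and 2m+2, both above m+k+2.
    have hij : (i = 1 ∧ j = 0) ∨ (i = 0 ∧ j = 0) ∨ (i = 0 ∧ j = 1) ∨ (i = 0 ∧ 2 ≤ j) := by
      rcases i with _ | _ | i
      · omega
      · rcases j with _ | j
        · omega
        · exfalso
          nlinarith
      · exfalso
        nlinarith
    rcases hij with ⟨rfl, rfl⟩ | ⟨rfl, rfl⟩ | ⟨rfl, rfl⟩ | ⟨rfl, hj⟩
    · refine ⟨Polynomial.monomial l c, 0, 0, 0, ?_, by simp, by simp, ?_, by simp, by simp, ?_⟩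
      · exact (Polynomial.natDegree_monomial_le c).trans (by omega)
      · simp [Polynomial.coeff_monomial]
      · rw [← Polynomial.C_mul_X_pow_eq_monomial]
        ring
    · refine ⟨0, 0, Polynomial.monomial l c, 0, by simp, by simp, ?_, by simp, by simp, ?_, ?_⟩
      · exact (Polynomial.natDegree_monomial_le c).trans (by omega)
      · simp [Polynomial.coeff_monomial]
      · rw [← Polynomial.C_mul_X_pow_eq_monomial]
        ring
    · refine ⟨0, Polynomial.monomial l c, 0, 0, by simp, ?_, by simp, by simp, ?_, by simp, ?_⟩
      · exact (Polynomial.natDegree_monomial_le c).trans (by omega)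
      · simp [Polynomial.coeff_monomial]
      · rw [← Polynomial.C_mul_X_pow_eq_monomial]
        ring
    · obtain ⟨s, rfl⟩ := Nat.exists_eq_add_of_le hj
      refine ⟨0, 0, 0, Polynomial.C c * ((Polynomial.X - 1) ^ p) ^ s * Polynomial.X ^ l,
        by simp, by simp, by simp, by simp, ?_, by simp, ?_⟩
      · rw [if_neg (by omega), Polynomial.coeff_zero]
      · ring

theorem coeff_zero_or_ne_zero {p k m : ℕ} (hm : k + 1 ≤ m) (hp : p = m + 2 * k + 3)
    {f : MvPolynomial (Fin 3) ℂ} (hfI : f ∈ curveIdeal p)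
    (hf : ∀ u ∈ f.support, (m + 2) * u 0 + m * u 1 + u 2 ≤ m + k + 2)
    (hne : coeff (expVec 1 0 k) f ≠ 0) :
    coeff (expVec 0 1 (k + 2)) f ≠ 0 ∧ coeff (expVec 0 0 (m + k + 2)) f ≠ 0 := by
  obtain ⟨A, B, C, E, hA, hB, hC, hA', hB', hC', h⟩ := exists_normalForm p hm f hf
  rw [mem_curveIdeal_iff.1 hfI] at h
  have hrest : A * (Polynomial.X + 1) ^ (p + 2) + B * (Polynomial.X - 1) ^ p + C = 0 := by
    by_contra h0
    -- The linear part would be a multiple of (X-1)^(2p), but its degree is at most p+k+2 < 2p. So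
    -- the y² terms cancel among themselves.
    have hd : ((Polynomial.X - 1 : Polynomial ℂ) ^ (p * 2)) ∣
        A * (Polynomial.X + 1) ^ (p + 2) + B * (Polynomial.X - 1) ^ p + C :=
      ⟨-E, by rw [pow_mul]; linear_combination -h⟩
    have h1 := Polynomial.natDegree_le_of_dvd hd h0
    rw [natDegree_X_sub_one_pow] at h1
    have h2 : (A * (Polynomial.X + 1) ^ (p + 2) + B * (Polynomial.X - 1) ^ p + C).natDegree ≤
        p + 2 + k := by
      refine Polynomial.natDegree_add_le_of_degree_le
        (Polynomial.natDegree_add_le_of_degree_le ?_ ?_) (hC.trans (by omega))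
      · refine Polynomial.natDegree_mul_le.trans ?_
        rw [natDegree_X_add_one_pow]
        omega
      · refine Polynomial.natDegree_mul_le.trans ?_
        rw [natDegree_X_sub_one_pow]
        omega
    omega
  -- Here deg A ≤ k and deg C ≤ m+k+2 = p-k-1, while deg A + deg C ≥ p-1: all bounds are equalities.
  obtain ⟨hA0, hB0, hC0, h1, h2⟩ := natDegree_of_relation (by omega) (by omega) (by omega) hrest
    (fun h0 => hne (by rw [← hA', h0.1, Polynomial.coeff_zero]))
  have hBk : B.natDegree = k + 2 := by omega
  have hCk : C.natDegree = m + k + 2 := by omega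
  rw [← hB', ← hC', ← hBk, ← hCk]
  exact ⟨Polynomial.leadingCoeff_ne_zero.2 hB0, Polynomial.leadingCoeff_ne_zero.2 hC0⟩

theorem exists_mem_curveIdeal {p k m : ℕ} (hp : p = m + 2 * k + 3) :
    ∃ F ∈ curveIdeal p, coeff (expVec 1 0 k) F ≠ 0 ∧
      ∀ u ∈ F.support, (m + 2) * u 0 + m * u 1 + u 2 ≤ m + k + 2 := by
  obtain ⟨A, B, C, hA, hB, hC, hne, h⟩ := exists_relation p k (by omega)
  obtain ⟨hA0, hB0, hC0, h1, h2⟩ :=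
    natDegree_of_relation (by omega) (by omega) (by omega) h hne
  refine ⟨_, inZ_mem_combination h, ?_, fun u hu => ?_⟩
  · rw [coeff_combination]
    have hAk : A.natDegree = k := by omega
    simpa [← hAk] using hA0
  · rw [mem_support_iff, coeff_combination] at hu
    by_contra hlt
    refine hu ?_
    rw [ite_eq_right_iff.2, ite_eq_right_iff.2, ite_eq_right_iff.2, add_zero, add_zero]
    · rintro ⟨h0, h1⟩
      rw [h0, h1] at hlt
      exact Polynomial.coeff_eq_zero_of_natDegree_lt (by omega)
    · rintro ⟨h0, h1⟩
      rw [h0, h1] at hlt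
      exact Polynomial.coeff_eq_zero_of_natDegree_lt (by omega)
    · rintro ⟨h0, h1⟩
      rw [h0, h1] at hlt
      exact Polynomial.coeff_eq_zero_of_natDegree_lt (by omega)

/-- The terms of top degree along the place at infinity of the curve cancel. -/
theorem sum_coeff_top_eq_zero {p d : ℕ} {f : MvPolynomial (Fin 3) ℂ} (hfI : f ∈ curveIdeal p)
    (hf : ∀ u ∈ f.support, (p + 2) * u 0 + p * u 1 + u 2 ≤ d) :
    ∑ u ∈ f.support, (if (p + 2) * u 0 + p * u 1 + u 2 = d then coeff u f else 0) = 0 := by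
  have h := mem_curveIdeal_iff.1 hfI
  rw [f.as_sum, map_sum] at h
  have h' := congrArg (fun P => Polynomial.coeff P d) h
  simp only [Polynomial.finsetSum_coeff, Polynomial.coeff_zero] at h'
  refine Eq.trans (Finset.sum_congr rfl fun u hu => ?_) h'
  have hmonic : (((Polynomial.X + 1 : Polynomial ℂ) ^ (p + 2)) ^ u 0 *
      ((Polynomial.X - 1) ^ p) ^ u 1 * Polynomial.X ^ u 2).Monic := by
    rw [← Polynomial.C_1]
    exact ((((Polynomial.monic_X_add_C 1).pow _).pow _).mul
      (((Polynomial.monic_X_sub_C 1).pow _).pow _)).mul (Polynomial.monic_X.pow _)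
  have hdeg : (((Polynomial.X + 1 : Polynomial ℂ) ^ (p + 2)) ^ u 0 *
      ((Polynomial.X - 1) ^ p) ^ u 1 * Polynomial.X ^ u 2).natDegree =
      (p + 2) * u 0 + p * u 1 + u 2 := by
    rw [← pow_mul, ← pow_mul, Polynomial.natDegree_mul
      (mul_ne_zero (X_add_one_pow_ne_zero _) (X_sub_one_pow_ne_zero _))
      (pow_ne_zero _ Polynomial.X_ne_zero), Polynomial.natDegree_mul
      (X_add_one_pow_ne_zero _) (X_sub_one_pow_ne_zero _), natDegree_X_add_one_pow,
      natDegree_X_sub_one_pow, Polynomial.natDegree_X_pow]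
  rw [curveMap_monomial, Polynomial.coeff_C_mul]
  split_ifs with hd
  · rw [← hd, ← hdeg, hmonic.coeff_natDegree, mul_one]
  · rw [Polynomial.coeff_eq_zero_of_natDegree_lt (hdeg ▸ lt_of_le_of_ne (hf u hu) hd), mul_zero]

/-! ### Weights with the same initial ideal as `rayVec q` -/

/-- The negative weight vector `-(q + 2, q, 1)`. -/
noncomputable def rayVec (q : ℕ) : Fin 3 → ℝ := ![-((q : ℝ) + 2), -(q : ℝ), -1]

theorem sum_rayVec_mul (q : ℕ) (u : Fin 3 →₀ ℕ) :
    ∑ i, rayVec q i * (u i : ℝ) = -(((q + 2) * u 0 + q * u 1 + u 2 : ℕ) : ℝ) := by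
  rw [Fin.sum_univ_three]
  simp only [rayVec, Matrix.cons_val_zero, Matrix.cons_val_one, Matrix.cons_val]
  push_cast
  ring

theorem rayVec_neg {q : ℕ} (hq : 1 ≤ q) (i : Fin 3) : rayVec q i < 0 := by
  have : (1 : ℝ) ≤ q := by exact_mod_cast hq
  fin_cases i <;> simp [rayVec] <;> linarith

theorem mem_minWeightSupport_rayVec {q : ℕ} {f : MvPolynomial (Fin 3) ℂ} {u : Fin 3 →₀ ℕ} :
    u ∈ minWeightSupport (rayVec q) f ↔ u ∈ f.support ∧ ∀ v ∈ f.support,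
      (q + 2) * v 0 + q * v 1 + v 2 ≤ (q + 2) * u 0 + q * u 1 + u 2 := by
  simp only [minWeightSupport, Set.mem_ofPred_eq, sum_rayVec_mul, neg_le_neg_iff, Nat.cast_le]

/-- The form of `exists_mem_of_initialIdeal_eq` for the weights `rayVec q`. -/
theorem exists_mem_of_initialIdeal_eq_rayVec {q d : ℕ} {v : Fin 3 → ℝ}
    {I : Ideal (MvPolynomial (Fin 3) ℂ)} (h : initialIdeal v I = initialIdeal (rayVec q) I)
    {F : MvPolynomial (Fin 3) ℂ} (hF : F ∈ I) {u₀ : Fin 3 →₀ ℕ} (hu₀ : coeff u₀ F ≠ 0)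
    (hd : (q + 2) * u₀ 0 + q * u₀ 1 + u₀ 2 = d)
    (hle : ∀ u ∈ F.support, (q + 2) * u 0 + q * u 1 + u 2 ≤ d) :
    ∃ f ∈ I, (∀ u ∈ f.support, (q + 2) * u 0 + q * u 1 + u 2 ≤ d) ∧
      ∀ u : Fin 3 →₀ ℕ, (q + 2) * u 0 + q * u 1 + u 2 = d → coeff u f =
        if ∑ i, v i * (u i : ℝ) = ∑ i, v i * (u₀ i : ℝ) then coeff u F else 0 := by
  subst hd
  obtain ⟨f, hf, hfF⟩ := exists_mem_of_initialIdeal_eq h hF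
    (mem_minWeightSupport_rayVec.2 ⟨mem_support_iff.2 hu₀, hle⟩)
  simp only [sum_rayVec_mul, neg_lt_neg_iff, neg_inj, Nat.cast_lt, Nat.cast_inj] at hfF
  refine ⟨f, hf, fun u hu => ?_, fun u hu => (hfF u).2 hu⟩
  by_contra hlt
  exact mem_support_iff.1 hu ((hfF u).1 (not_le.1 hlt))

theorem C_mem_curveIdeal_iff {p : ℕ} {c : ℂ} : C c ∈ curveIdeal p ↔ c = 0 := by
  rw [mem_curveIdeal_iff, curveMap, aeval_C, Polynomial.algebraMap_apply, Algebra.algebraMap_self,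
    RingHom.id_apply, Polynomial.C_eq_zero]

theorem inZ_X_add_C_pow (c : ℂ) (n : ℕ) :
    inZ ((Polynomial.X + Polynomial.C c) ^ n) = (X 2 + C c) ^ n := by
  simp [inZ, MvPolynomial.algebraMap_eq]

theorem coeff_X_sub_pow (i : Fin 3) (c : ℂ) (n : ℕ) (u : Fin 3 →₀ ℕ) :
    coeff u (X i - (X 2 + C c) ^ n : MvPolynomial (Fin 3) ℂ) =
      (if u = Finsupp.single i 1 then 1 else 0) - (if u 0 = 0 ∧ u 1 = 0 then
        ((Polynomial.X + Polynomial.C c) ^ n).coeff (u 2) else 0) := by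
  classical
  rw [coeff_sub, ← inZ_X_add_C_pow, coeff_inZ, coeff_X]
  simp only [eq_comm]

/-- For v ≥ 0 the constant term of x - (z+1)^(p+2) survives in its initial form. For negative r, an
element of the ideal without terms of negative weight is a constant, hence zero. This fixes the sign
of the scalar in `exists_pos_smul_rayVec`. -/
theorem initialIdeal_ne_of_nonneg {p : ℕ} {r v : Fin 3 → ℝ} (hr : ∀ i, r i < 0)
    (hv : ∀ i, 0 ≤ v i) : initialIdeal v (curveIdeal p) ≠ initialIdeal r (curveIdeal p) := by
  classical
  intro h
  have hF : (X 0 - (X 2 + C 1) ^ (p + 2) : MvPolynomial (Fin 3) ℂ) ∈ curveIdeal p :=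
    Ideal.subset_span (by simp)
  have h0 : coeff 0 (X 0 - (X 2 + C 1) ^ (p + 2) : MvPolynomial (Fin 3) ℂ) ≠ 0 := by
    rw [coeff_X_sub_pow, if_neg, if_pos (by simp)]
    · rw [Finsupp.coe_zero, Pi.zero_apply, Polynomial.coeff_zero_eq_eval_zero]
      simp
    · exact (Finsupp.single_ne_zero.2 one_ne_zero).symm
  have hmem := initialForm_mem_initialIdeal v hF
  rw [h] at hmem
  obtain ⟨f, hf, hfF⟩ := exists_mem_of_mem_initialIdeal hmem 0
  have hfC : f = C (coeff 0 f) := by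
    ext u
    rw [coeff_C]
    split_ifs with hu
    · rw [hu]
    · apply (hfF u).1
      obtain ⟨i, hi⟩ := Finsupp.ne_iff.1 (Ne.symm hu)
      refine Finset.sum_neg' (fun j _ => mul_nonpos_of_nonpos_of_nonneg (hr j).le (Nat.cast_nonneg _))
        ⟨i, Finset.mem_univ i, mul_neg_of_neg_of_pos (hr i) ?_⟩
      exact_mod_cast Nat.pos_of_ne_zero hi
  rw [hfC, C_mem_curveIdeal_iff, (hfF 0).2 (by simp), coeff_initialForm, if_pos] at hf
  · exact h0 hf
  · refine ⟨mem_support_iff.2 h0, fun u _ => ?_⟩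
    simp only [Finsupp.coe_zero, Pi.zero_apply, Nat.cast_zero, mul_zero, Finset.sum_const_zero]
    exact Finset.sum_nonneg fun i _ => mul_nonneg (hv i) (Nat.cast_nonneg _)

theorem exists_pos_smul_rayVec {p q : ℕ} (hq : 1 ≤ q) {v : Fin 3 → ℝ}
    (h : initialIdeal v (curveIdeal p) = initialIdeal (rayVec q) (curveIdeal p))
    (h0 : v 0 = (q + 2) * v 2) (h1 : v 1 = q * v 2) :
    ∃ t : ℝ, 0 < t ∧ v = t • rayVec q := by
  refine ⟨-v 2, ?_, ?_⟩
  · by_contra hv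
    have hv : 0 ≤ v 2 := by linarith
    refine initialIdeal_ne_of_nonneg (rayVec_neg hq) (fun i => ?_) h
    fin_cases i
    · simp only [Fin.zero_eta, h0]
      positivity
    · simp only [Fin.mk_one, h1]
      positivity
    · exact hv
  · funext i
    fin_cases i <;> simp [rayVec, h0, h1] <;> ring

theorem sum_mul_expVec (v : Fin 3 → ℝ) (i j l : ℕ) :
    ∑ s, v s * (expVec i j l s : ℝ) = v 0 * i + v 1 * j + v 2 * l := by
  rw [Fin.sum_univ_three]
  simp

/-- A component of the initial form that contains x z^k must also contain y z^(k+2) and z^(m+k+2),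
so `v` weighs the three equally; these two equations are the claim. -/
theorem weights_of_initialIdeal_eq {p k m : ℕ} (hm : k + 1 ≤ m) (hp : p = m + 2 * k + 3)
    {v : Fin 3 → ℝ}
    (h : initialIdeal v (curveIdeal p) = initialIdeal (rayVec m) (curveIdeal p)) :
    v 0 = (m + 2) * v 2 ∧ v 1 = m * v 2 := by
  obtain ⟨F, hF, hF0, hFle⟩ := exists_mem_curveIdeal (k := k) hp
  obtain ⟨f, hf, hfle, hfF⟩ := exists_mem_of_initialIdeal_eq_rayVec h hF hF0
    (d := m + k + 2) (by simp; omega) hFle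
  have h1 : coeff (expVec 1 0 k) f ≠ 0 := by
    rw [hfF _ (by simp; omega), if_pos rfl]
    exact hF0
  obtain ⟨h2, h3⟩ := coeff_zero_or_ne_zero hm hp hf hfle h1
  rw [hfF _ (by simp; omega)] at h2
  rw [hfF _ (by simp)] at h3
  have h2' := (ite_ne_right_iff.1 h2).1
  have h3' := (ite_ne_right_iff.1 h3).1
  rw [sum_mul_expVec, sum_mul_expVec] at h2' h3'
  push_cast at h2' h3'
  constructor <;> linarith

/-- If `v` separated the only two possible top exponents, some element of the ideal would have a
single top term along z = ∞, and nothing could cancel it. -/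
theorem weights_of_initialIdeal_eq_infinity_aux {p d : ℕ} {v : Fin 3 → ℝ} {F : MvPolynomial (Fin 3) ℂ}
    (hF : F ∈ curveIdeal p)
    (h : initialIdeal v (curveIdeal p) = initialIdeal (rayVec p) (curveIdeal p))
    {u₀ u₁ : Fin 3 →₀ ℕ} (hu₀ : coeff u₀ F ≠ 0)
    (hd : (p + 2) * u₀ 0 + p * u₀ 1 + u₀ 2 = d)
    (hle : ∀ u ∈ F.support, (p + 2) * u 0 + p * u 1 + u 2 ≤ d)
    (hlt : ∀ u ∈ F.support, u ≠ u₀ → u ≠ u₁ → (p + 2) * u 0 + p * u 1 + u 2 < d) :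
    ∑ i, v i * (u₁ i : ℝ) = ∑ i, v i * (u₀ i : ℝ) := by
  obtain ⟨f, hf, hfle, hfF⟩ := exists_mem_of_initialIdeal_eq_rayVec h hF hu₀ hd hle
  by_contra hne
  have hsum := sum_coeff_top_eq_zero hf hfle
  have hu₀f : coeff u₀ f = coeff u₀ F := by rw [hfF _ hd, if_pos rfl]
  rw [Finset.sum_eq_single u₀, if_pos hd, hu₀f] at hsum
  · exact hu₀ hsum
  · intro u hu huu
    split_ifs with hud
    · rw [hfF u hud]
      split_ifs with hv
      · by_contra hc
        have hu1 : u ≠ u₁ := by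
          rintro rfl
          exact hne hv
        exact (hlt u (mem_support_iff.2 hc) huu hu1).ne hud
      · rfl
    · rfl
  · intro hu
    rw [mem_support_iff, hu₀f] at hu
    exact absurd hu₀ hu

theorem mem_support_X_sub_pow {i : Fin 3} {c : ℂ} {n : ℕ} {u : Fin 3 →₀ ℕ}
    (hu : u ∈ (X i - (X 2 + C c) ^ n : MvPolynomial (Fin 3) ℂ).support) :
    u = Finsupp.single i 1 ∨ ∃ l ≤ n, u = expVec 0 0 l := by
  rw [mem_support_iff, coeff_X_sub_pow] at hu
  by_contra! hcon
  rw [if_neg hcon.1, zero_sub, neg_ne_zero, ite_ne_right_iff] at hu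
  refine hcon.2 (u 2) ?_ (eq_expVec_iff.2 ⟨hu.1.1, hu.1.2, rfl⟩)
  by_contra! hlt
  refine hu.2 (Polynomial.coeff_eq_zero_of_natDegree_lt ?_)
  rwa [Polynomial.natDegree_pow, Polynomial.natDegree_X_add_C, mul_one]

theorem coeff_single_X_sub_pow {i : Fin 3} (hi : i ≠ 2) (c : ℂ) (n : ℕ) :
    coeff (Finsupp.single i 1) (X i - (X 2 + C c) ^ n : MvPolynomial (Fin 3) ℂ) = 1 := by
  rw [coeff_X_sub_pow, if_pos rfl, if_neg, sub_zero]
  fin_cases i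
  · simp
  · simp
  · exact absurd rfl hi

theorem X_sub_pow_mem_curveIdeal (p : ℕ) :
    (X 0 - (X 2 + C 1) ^ (p + 2) : MvPolynomial (Fin 3) ℂ) ∈ curveIdeal p ∧
      (X 1 - (X 2 + C (-1)) ^ p : MvPolynomial (Fin 3) ℂ) ∈ curveIdeal p := by
  constructor <;> refine Ideal.subset_span ?_ <;> simp [sub_eq_add_neg]

theorem single_zero_eq : (Finsupp.single 0 1 : Fin 3 →₀ ℕ) = expVec 1 0 0 :=
  eq_expVec_iff.2 (by simp)

theorem single_one_eq : (Finsupp.single 1 1 : Fin 3 →₀ ℕ) = expVec 0 1 0 :=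
  eq_expVec_iff.2 (by simp)

theorem weights_of_initialIdeal_eq_infinity {p : ℕ} {v : Fin 3 → ℝ}
    (h : initialIdeal v (curveIdeal p) = initialIdeal (rayVec p) (curveIdeal p)) :
    v 0 = (p + 2) * v 2 ∧ v 1 = p * v 2 := by
  constructor
  · have hmem : ∀ u ∈ (X 0 - (X 2 + C 1) ^ (p + 2) : MvPolynomial (Fin 3) ℂ).support,
        u = expVec 1 0 0 ∨ ∃ l ≤ p + 2, u = expVec 0 0 l := fun u hu =>
      single_zero_eq ▸ mem_support_X_sub_pow hu
    have := weights_of_initialIdeal_eq_infinity_aux (X_sub_pow_mem_curveIdeal p).1 h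
      (u₀ := expVec 1 0 0) (u₁ := expVec 0 0 (p + 2)) (d := p + 2)
      (by rw [← single_zero_eq, coeff_single_X_sub_pow (by decide)]; exact one_ne_zero)
      (by simp) (fun u hu => ?_) (fun u hu h0 h1 => ?_)
    · rw [sum_mul_expVec, sum_mul_expVec] at this
      push_cast at this
      linarith
    · rcases hmem u hu with rfl | ⟨l, hl, rfl⟩
      · simp
      · simpa using hl
    · rcases hmem u hu with rfl | ⟨l, hl, rfl⟩
      · exact absurd rfl h0
      · have : l ≠ p + 2 := fun hl => h1 (hl ▸ rfl)
        simp only [expVec_zero, expVec_one, expVec_two]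
        omega
  · have hmem : ∀ u ∈ (X 1 - (X 2 + C (-1)) ^ p : MvPolynomial (Fin 3) ℂ).support,
        u = expVec 0 1 0 ∨ ∃ l ≤ p, u = expVec 0 0 l := fun u hu =>
      single_one_eq ▸ mem_support_X_sub_pow hu
    have := weights_of_initialIdeal_eq_infinity_aux (X_sub_pow_mem_curveIdeal p).2 h
      (u₀ := expVec 0 1 0) (u₁ := expVec 0 0 p) (d := p)
      (by rw [← single_one_eq, coeff_single_X_sub_pow (by decide)]; exact one_ne_zero)
      (by simp) (fun u hu => ?_) (fun u hu h0 h1 => ?_)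
    · rw [sum_mul_expVec, sum_mul_expVec] at this
      push_cast at this
      linarith
    · rcases hmem u hu with rfl | ⟨l, hl, rfl⟩
      · simp
      · simpa using hl
    · rcases hmem u hu with rfl | ⟨l, hl, rfl⟩
      · exact absurd rfl h0
      · have : l ≠ p := fun hl => h1 (hl ▸ rfl)
        simp only [expVec_zero, expVec_one, expVec_two]
        omega

/-! ### Counting the rays of the Gröbner fan -/

theorem isRay_halfLine {n : ℕ} {v : Fin n → ℝ} (hv : v ≠ 0) : IsRay (halfLine v) := ⟨v, hv, rfl⟩

theorem mem_halfLine_self {n : ℕ} (v : Fin n → ℝ) : v ∈ halfLine v :=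
  ⟨1, zero_le_one, (one_smul ℝ v).symm⟩

theorem halfLine_rayVec_injective : Function.Injective fun q => halfLine (rayVec q) := by
  intro q q' h
  have hmem : rayVec q ∈ halfLine (rayVec q') := (show halfLine (rayVec q) = halfLine (rayVec q') from
    h) ▸ mem_halfLine_self _
  obtain ⟨t, -, ht⟩ := hmem
  have h1 := congrFun ht 1
  have h2 := congrFun ht 2
  simp [rayVec] at h1 h2
  rw [← h2, one_mul] at h1
  exact_mod_cast h1

theorem card_le_rays_groebnerFan (p : ℕ) (hp : 1 ≤ p) :
    ((p : ℕ∞) + 1) ≤ 4 * {r | r ∈ groebnerFan (curveIdeal p) ∧ IsRay r}.encard := by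
  classical
  -- For m = p-2k-3 the condition m ≥ k+1 reads 3k+4 ≤ p, that is, k < (p-1)/3 with integer
  -- division. The extra element p is the ray at infinity.
  let Q : Finset ℕ := insert p ((Finset.range ((p - 1) / 3)).image fun k => p - (2 * k + 3))
  have hQcard : Q.card = (p - 1) / 3 + 1 := by
    rw [Finset.card_insert_of_notMem, Finset.card_image_of_injOn, Finset.card_range]
    · intro a ha b hb hab
      simp only [Finset.coe_range, Set.mem_Iio] at ha hb hab
      omega
    · simp only [Finset.mem_image, Finset.mem_range, not_exists, not_and]
      intro k hk
      omega
  have hsub : (fun q => halfLine (rayVec q)) '' (Q : Set ℕ) ⊆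
      {r | r ∈ groebnerFan (curveIdeal p) ∧ IsRay r} := by
    rintro _ ⟨q, hq, rfl⟩
    have key : 1 ≤ q ∧ ∀ v, initialIdeal v (curveIdeal p) =
        initialIdeal (rayVec q) (curveIdeal p) → v 0 = (q + 2) * v 2 ∧ v 1 = q * v 2 := by
      rcases Finset.mem_insert.1 hq with rfl | hq
      · exact ⟨hp, fun v hv => weights_of_initialIdeal_eq_infinity hv⟩
      · obtain ⟨k, hk, rfl⟩ := Finset.mem_image.1 hq
        rw [Finset.mem_range] at hk
        exact ⟨by omega, fun v hv => weights_of_initialIdeal_eq (k := k) (by omega) (by omega) hv⟩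
    have hneg := rayVec_neg key.1
    refine ⟨halfLine_mem_groebnerFan hneg fun v hv =>
      exists_pos_smul_rayVec key.1 hv (key.2 v hv).1 (key.2 v hv).2, isRay_halfLine fun h0 => ?_⟩
    exact (hneg 0).ne (congrFun h0 0)
  have hle := Set.encard_le_encard hsub
  rw [halfLine_rayVec_injective.encard_image, Set.encard_coe_eq_coe_finsetCard, hQcard] at hle
  refine le_trans ?_ (mul_le_mul_right hle 4)
  have : p + 1 ≤ 4 * ((p - 1) / 3 + 1) := by omega
  exact_mod_cast this

/-! ### The tropical curve -/

/-- Generators of the four rays of the tropical curve. -/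
noncomputable def tropicalRay (p : ℕ) : Fin 4 → Fin 3 → ℝ :=
  ![Pi.single 0 1, Pi.single 1 1, Pi.single 2 1, rayVec p]

theorem curveMap_X_eval_root (p : ℕ) (hp : 1 ≤ p) (i : Fin 3) :
    ∃ a : ℂ, ∀ j, (curveMap p (X j)).eval a = 0 ↔ j = i := by
  have h2 : (1 + 1 : ℂ) ≠ 0 := by norm_num
  have h3 : (-1 - 1 : ℂ) ≠ 0 := by norm_num
  fin_cases i
  · refine ⟨-1, fun j => ?_⟩
    fin_cases j <;> simp [curveMap, h3]
  · refine ⟨1, fun j => ?_⟩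
    have : p ≠ 0 := by omega
    fin_cases j <;> simp [curveMap, h2, this]
  · refine ⟨0, fun j => ?_⟩
    fin_cases j <;> simp [curveMap]

theorem curveMap_monomial_eq_prod (p : ℕ) (u : Fin 3 →₀ ℕ) (c : ℂ) :
    curveMap p (monomial u c) = Polynomial.C c * ∏ j, curveMap p (X j) ^ u j := by
  rw [curveMap, aeval_monomial, Finsupp.prod_fintype _ _ (fun i => pow_zero _)]
  simp

/-- At a point of the curve where only the `i`-th coordinate vanishes, a unique term of least order
in that coordinate cannot be cancelled: divide by this power and evaluate. -/
theorem halfLine_single_subset {p : ℕ} (hp : 1 ≤ p) (i : Fin 3) :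
    halfLine (Pi.single i 1) ⊆ tropicalVariety (curveIdeal p) := by
  classical
  rintro _ ⟨t, ht, rfl⟩
  simp only [tropicalVariety, Set.mem_iInter]
  intro f hf hmon
  obtain ⟨u, hu, h⟩ := (initialForm_eq_monomial_iff _ _).1 hmon
  have hsum : ∀ v : Fin 3 →₀ ℕ,
      ∑ j, (t • (Pi.single i 1 : Fin 3 → ℝ)) j * (v j : ℝ) = t * v i := by
    intro v
    rw [Finset.sum_eq_single i]
    · simp
    · intro j _ hj
      simp [hj]
    · simp
  simp only [hsum] at h
  obtain ⟨a, ha⟩ := curveMap_X_eval_root p hp i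
  set P : Fin 3 → Polynomial ℂ := fun j => curveMap p (X j) with hP
  have hdvd : ∀ v ∈ f.support.erase u, P i ^ (u i + 1) ∣ curveMap p (monomial v (coeff v f)) := by
    intro v hv
    rw [Finset.mem_erase] at hv
    have hlt : u i < v i := by
      exact_mod_cast lt_of_mul_lt_mul_left (h v hv.2 hv.1) ht
    rw [curveMap_monomial_eq_prod]
    exact Dvd.dvd.mul_left ((pow_dvd_pow _ hlt).trans
      (Finset.dvd_prod_of_mem (fun j => P j ^ v j) (Finset.mem_univ i))) _
  have hzero := mem_curveIdeal_iff.1 hf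
  rw [f.as_sum, map_sum, ← Finset.add_sum_erase _ _ hu] at hzero
  obtain ⟨Q, hQ⟩ := Finset.dvd_sum hdvd
  rw [hQ, curveMap_monomial_eq_prod, ← Finset.mul_prod_erase _ _ (Finset.mem_univ i)] at hzero
  have hPi : P i ≠ 0 := by
    intro h0
    obtain ⟨j, hj⟩ : ∃ j : Fin 3, j ≠ i := exists_ne i
    obtain ⟨b, hb⟩ := curveMap_X_eval_root p hp j
    exact hj ((hb i).1 (by rw [show curveMap p (X i) = 0 from h0, Polynomial.eval_zero])).symm
  have hcancel : Polynomial.C (coeff u f) * ∏ j ∈ Finset.univ.erase i, P j ^ u j + P i * Q = 0 := by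
    apply mul_left_cancel₀ (pow_ne_zero (u i) hPi)
    rw [mul_zero, ← hzero]
    ring
  have hev := congrArg (Polynomial.eval a) hcancel
  rw [Polynomial.eval_add, Polynomial.eval_mul, Polynomial.eval_mul, (ha i).2 rfl, zero_mul,
    add_zero, Polynomial.eval_C, Polynomial.eval_zero, Polynomial.eval_prod] at hev
  refine (mul_ne_zero (mem_support_iff.1 hu) (Finset.prod_ne_zero_iff.2 fun j hj => ?_)) hev
  rw [Polynomial.eval_pow]
  exact pow_ne_zero _ fun h0 => (Finset.mem_erase.1 hj).1 ((ha j).1 h0)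

theorem halfLine_rayVec_subset (p : ℕ) :
    halfLine (rayVec p) ⊆ tropicalVariety (curveIdeal p) := by
  classical
  rintro _ ⟨t, ht, rfl⟩
  simp only [tropicalVariety, Set.mem_iInter]
  intro f hf hmon
  obtain ⟨u, hu, h⟩ := (initialForm_eq_monomial_iff _ _).1 hmon
  simp only [Pi.smul_apply, smul_eq_mul, mul_assoc, ← Finset.mul_sum, sum_rayVec_mul] at h
  have hlt : ∀ v ∈ f.support, v ≠ u →
      (p + 2) * v 0 + p * v 1 + v 2 < (p + 2) * u 0 + p * u 1 + u 2 := by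
    intro v hv hvu
    have := lt_of_mul_lt_mul_left (h v hv hvu) ht
    rw [neg_lt_neg_iff] at this
    exact_mod_cast this
  have hsum := sum_coeff_top_eq_zero (d := (p + 2) * u 0 + p * u 1 + u 2) hf fun v hv => by
    by_cases hvu : v = u
    · rw [hvu]
    · exact (hlt v hv hvu).le
  rw [Finset.sum_eq_single_of_mem u hu fun v hv hvu => if_neg (hlt v hv hvu).ne, if_pos rfl] at hsum
  exact mem_support_iff.1 hu hsum

/-- Since c ≠ 0, both 1 and z^n occur in (z+c)^n, and the lightest power of z is one of them unless
w 2 = 0. The minimum must be shared with the variable `X i`. -/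
theorem weights_of_mem_tropicalHypersurface {i : Fin 3} (hi : i ≠ 2) {c : ℂ} (hc : c ≠ 0) {n : ℕ}
    {w : Fin 3 → ℝ}
    (hw : w ∈ tropicalHypersurface (X i - (X 2 + C c) ^ n)) :
    (0 < w 2 → w i = 0) ∧ (w 2 = 0 → 0 ≤ w i) ∧ (w 2 < 0 → w i = n * w 2) := by
  classical
  have hw' : ¬ ∃ u ∈ (X i - (X 2 + C c) ^ n : MvPolynomial (Fin 3) ℂ).support,
      ∀ v ∈ (X i - (X 2 + C c) ^ n : MvPolynomial (Fin 3) ℂ).support, v ≠ u →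
        ∑ i, w i * (u i : ℝ) < ∑ i, w i * (v i : ℝ) :=
    fun h => hw ((initialForm_eq_monomial_iff _ _).2 h)
  have hsi : Finsupp.single i 1 ∈ (X i - (X 2 + C c) ^ n : MvPolynomial (Fin 3) ℂ).support := by
    rw [mem_support_iff, coeff_single_X_sub_pow hi]
    exact one_ne_zero
  have hne : ∀ l, expVec 0 0 l ≠ Finsupp.single i 1 := by
    intro l hl
    have h0 := DFunLike.congr_fun hl 0
    have h1 := DFunLike.congr_fun hl 1
    fin_cases i
    · simp at h0
    · simp at h1
    · exact hi rfl
  have hcz : ∀ l, coeff (expVec 0 0 l) (X i - (X 2 + C c) ^ n : MvPolynomial (Fin 3) ℂ) =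
      -((Polynomial.X + Polynomial.C c) ^ n).coeff l := by
    intro l
    rw [coeff_X_sub_pow, if_neg (hne l), if_pos ⟨rfl, rfl⟩, zero_sub, expVec_two]
  have hs0 : expVec 0 0 0 ∈ (X i - (X 2 + C c) ^ n : MvPolynomial (Fin 3) ℂ).support := by
    rw [mem_support_iff, hcz, neg_ne_zero, Polynomial.coeff_zero_eq_eval_zero]
    simpa using fun h => absurd h hc
  have hsn : expVec 0 0 n ∈ (X i - (X 2 + C c) ^ n : MvPolynomial (Fin 3) ℂ).support := by
    rw [mem_support_iff, hcz, neg_ne_zero]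
    have hm := (Polynomial.monic_X_add_C c).pow n
    have hd : ((Polynomial.X + Polynomial.C c) ^ n).natDegree = n := by
      rw [Polynomial.natDegree_pow, Polynomial.natDegree_X_add_C, mul_one]
    have := hm.coeff_natDegree
    rw [hd] at this
    rw [this]
    exact one_ne_zero
  have hwi : ∑ s, w s * ((Finsupp.single i 1 : Fin 3 →₀ ℕ) s : ℝ) = w i := by
    rw [Finset.sum_eq_single i]
    · simp
    · intro j _ hj
      simp [hj]
    · simp
  have hwl : ∀ l, ∑ s, w s * (expVec 0 0 l s : ℝ) = w 2 * l := by
    intro l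
    rw [sum_mul_expVec]
    simp
  have hX : ¬ ∀ l ≤ n, w i < w 2 * l := by
    intro h
    refine hw' ⟨_, hsi, fun v hv hvu => ?_⟩
    rcases mem_support_X_sub_pow hv with rfl | ⟨l, hl, rfl⟩
    · exact absurd rfl hvu
    · rw [hwi, hwl]
      exact h l hl
  have hL : ∀ k, expVec 0 0 k ∈ (X i - (X 2 + C c) ^ n : MvPolynomial (Fin 3) ℂ).support →
      (∀ l ≤ n, l ≠ k → w 2 * k < w 2 * l) → w i ≤ w 2 * k := by
    intro k hk h
    by_contra! hlt
    refine hw' ⟨_, hk, fun v hv hvu => ?_⟩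
    rcases mem_support_X_sub_pow hv with rfl | ⟨l, hl, rfl⟩
    · rw [hwi, hwl]
      exact hlt
    · rw [hwl, hwl]
      exact h l hl fun h => hvu (h ▸ rfl)
  push Not at hX
  obtain ⟨l, hl, hle⟩ := hX
  refine ⟨fun h2 => ?_, fun h2 => ?_, fun h2 => ?_⟩
  · have h1 := hL 0 hs0 fun l _ h0 => by
      rw [Nat.cast_zero, mul_zero]
      exact mul_pos h2 (by exact_mod_cast Nat.pos_of_ne_zero h0)
    rw [Nat.cast_zero, mul_zero] at h1
    exact le_antisymm h1 ((mul_nonneg h2.le (Nat.cast_nonneg l)).trans hle)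
  · rwa [h2, zero_mul] at hle
  · have h1 := hL n hsn fun l hl h0 =>
      mul_lt_mul_of_neg_left (by exact_mod_cast lt_of_le_of_ne hl h0) h2
    refine le_antisymm (by linarith) (le_trans ?_ hle)
    rw [mul_comm]
    exact mul_le_mul_of_nonpos_left (by exact_mod_cast hl) h2.le

theorem not_mem_tropicalVariety_of_pos {p : ℕ} {w : Fin 3 → ℝ} (h0 : 0 < w 0) (h1 : 0 < w 1)
    (h2 : w 2 = 0) : w ∉ tropicalVariety (curveIdeal p) := by
  classical
  intro hw
  -- The Bézout relation gives A x + B y - 1 in the ideal, and for these weights its initial form is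
  -- the constant -1.
  obtain ⟨A, B, h⟩ := isCoprime_X_add_one_X_sub_one.pow (m := p + 2) (n := p)
  have hmem := inZ_mem_combination (p := p) (A := A) (B := B) (C := -1) (by linear_combination h)
  simp only [tropicalVariety, Set.mem_iInter] at hw
  refine hw _ hmem ((initialForm_eq_monomial_iff _ _).2 ⟨0, ?_, fun v hv hv0 => ?_⟩)
  · rw [mem_support_iff, coeff_combination]
    simp
  · rw [mem_support_iff, coeff_combination] at hv
    rw [Fin.sum_univ_three, Fin.sum_univ_three, h2]
    simp only [Finsupp.coe_zero, Pi.zero_apply, Nat.cast_zero, mul_zero, zero_mul, add_zero]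
    by_cases hz : v 0 = 0 ∧ v 1 = 0
    · exfalso
      refine hv ?_
      have hv2 : v 2 ≠ 0 := by
        intro hv2
        apply hv0
        ext s
        fin_cases s
        exacts [hz.1, hz.2, hv2]
      rw [if_neg (by omega), if_neg (by omega), if_pos hz, Polynomial.coeff_neg,
        Polynomial.coeff_one, if_neg hv2]
      simp
    · rcases Nat.eq_zero_or_pos (v 0) with hv0 | hv0
      · have hv1 : 0 < v 1 := by omega
        have : 0 < w 1 * (v 1 : ℝ) := mul_pos h1 (by exact_mod_cast hv1)
        positivity
      · have : 0 < w 0 * (v 0 : ℝ) := mul_pos h0 (by exact_mod_cast hv0)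
        positivity

theorem tropicalVariety_curveIdeal {p : ℕ} (hp : 1 ≤ p) :
    tropicalVariety (curveIdeal p) = ⋃ i, halfLine (tropicalRay p i) := by
  apply Set.Subset.antisymm
  · intro w hw
    have hw' := hw
    simp only [tropicalVariety, Set.mem_iInter] at hw'
    obtain ⟨a1, a2, a3⟩ := weights_of_mem_tropicalHypersurface (by decide) one_ne_zero
      (hw' _ (X_sub_pow_mem_curveIdeal p).1)
    obtain ⟨b1, b2, b3⟩ := weights_of_mem_tropicalHypersurface (by decide)
      (neg_ne_zero.2 one_ne_zero) (hw' _ (X_sub_pow_mem_curveIdeal p).2)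
    rw [Set.mem_iUnion]
    rcases lt_trichotomy (w 2) 0 with h | h | h
    · refine ⟨3, -w 2, by linarith, ?_⟩
      funext i
      fin_cases i <;> simp [tropicalRay, rayVec, a3 h, b3 h] <;> ring
    · by_cases h0 : w 0 = 0
      · refine ⟨1, w 1, b2 h, ?_⟩
        funext i
        fin_cases i <;> simp [tropicalRay, h, h0]
      · by_cases h1 : w 1 = 0
        · refine ⟨0, w 0, a2 h, ?_⟩
          funext i
          fin_cases i <;> simp [tropicalRay, h, h1]
        · exact absurd hw (not_mem_tropicalVariety_of_pos (lt_of_le_of_ne (a2 h) (Ne.symm h0))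
            (lt_of_le_of_ne (b2 h) (Ne.symm h1)) h)
    · refine ⟨2, w 2, h.le, ?_⟩
      funext i
      fin_cases i <;> simp [tropicalRay, a1 h, b1 h]
  · refine Set.iUnion_subset fun i => ?_
    fin_cases i
    · exact halfLine_single_subset hp 0
    · exact halfLine_single_subset hp 1
    · exact halfLine_single_subset hp 2
    · exact halfLine_rayVec_subset p

theorem halfLine_tropicalRay_injective (p : ℕ) :
    Function.Injective fun i => halfLine (tropicalRay p i) := by
  intro i j h
  have hmem : tropicalRay p i ∈ halfLine (tropicalRay p j) :=
    (show halfLine (tropicalRay p i) = halfLine (tropicalRay p j) from h) ▸ mem_halfLine_self _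
  obtain ⟨t, ht, h⟩ := hmem
  have h0 := congrFun h 0
  have h1 := congrFun h 1
  have h2 := congrFun h 2
  fin_cases i <;> fin_cases j <;> simp [tropicalRay, rayVec] at h0 h1 h2 ⊢ <;> nlinarith

theorem tropicalRay_ne_zero (p : ℕ) (i : Fin 4) : tropicalRay p i ≠ 0 := by
  intro h
  have h0 := congrFun h 0
  have h1 := congrFun h 1
  have h2 := congrFun h 2
  fin_cases i <;> simp [tropicalRay, rayVec] at h0 h1 h2

theorem mainTheorem7 (p : ℕ) (hp : 1 ≤ p) :
    (∃ R : Set (Set (Fin 3 → ℝ)),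
      R.encard = 4 ∧ (∀ r ∈ R, IsRay r) ∧ tropicalVariety (curveIdeal p) = ⋃₀ R) ∧
    ((p : ℕ∞) + 1) ≤ 4 * {r | r ∈ groebnerFan (curveIdeal p) ∧ IsRay r}.encard := by
  refine ⟨⟨Set.range fun i => halfLine (tropicalRay p i), ?_, ?_, ?_⟩,
    card_le_rays_groebnerFan p hp⟩
  · rw [← Set.image_univ, (halfLine_tropicalRay_injective p).encard_image, Set.encard_univ]
    simp
  · rintro _ ⟨i, rfl⟩
    exact isRay_halfLine (tropicalRay_ne_zero p i)
  · rw [tropicalVariety_curveIdeal hp, Set.sUnion_range]
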